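/- Let $n\ge 1$ be an integer, let $W(u)=\frac{u^2}{2}-\frac{u^{n+2}}{(n+1)(n+2)}$ and $H(u,v)=\frac{v^2}{2}+W(u)$, and let $d_n=\frac{n(n+1)^{2/n}}{2(n+2)}$. For every $h\in(0,d_n)$ the Hamiltonian system $u'=v$, $v'=-u+\frac{u^{n+1}}{n+1}$ has a periodic orbit on the energy level $H(u,v)=h$. Let $\Gamma_h$ denote such a periodic orbit, traversed once in the direction of the flow, and put $$B_n(h)=\oint_{\Gamma_h}u^n v\,\mathrm{d}u,\qquad B_0(h)=\oint_{\Gamma_h}v\,\mathrm{d}u .$$ Then $B_0(h)>0$ for all $h\in(0,d_n)$, and the ratio $\tilde B_n(h)=B_n(h)/B_0(h)$ is differentiable with $\tilde B_n'(h)>0$ for all $h\in(0,d_n)$, and $\lim_{h\to 0^+}\tilde B_n(h)=0$. -/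

import Mathlib

open Set Filter Topology

noncomputable section

namespace AbelianRatio

/-- The potential `W(u) = u² / 2 - u ^ (n + 2) / ((n + 1) (n + 2))`. -/
def potential (n : ℕ) (u : ℝ) : ℝ :=
  u ^ 2 / 2 - u ^ (n + 2) / (((n : ℝ) + 1) * ((n : ℝ) + 2))

/-- The Hamiltonian `H(u, v) = v² / 2 + W(u)`. -/
def hamiltonian (n : ℕ) (u v : ℝ) : ℝ :=
  v ^ 2 / 2 + potential n u

/-- The critical energy `d_n = n (n + 1) ^ (2 / n) / (2 (n + 2))`. -/
def criticalEnergy (n : ℕ) : ℝ :=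
  (n : ℝ) * ((n : ℝ) + 1) ^ ((2 : ℝ) / (n : ℝ)) / (2 * ((n : ℝ) + 2))

/-- `(u, v)` is a periodic solution, of minimal period `T`, of the Hamiltonian system
`u' = v`, `v' = -u + u ^ (n + 1) / (n + 1)`, lying on the energy level `H = h`.
Over the time interval `[0, T]` it runs through the periodic orbit exactly once, in the direction
of the flow. -/
structure IsPeriodicOrbit (n : ℕ) (h : ℝ) (u v : ℝ → ℝ) (T : ℝ) : Prop where
  hasDerivAt_u : ∀ t : ℝ, HasDerivAt u (v t) t
  hasDerivAt_v : ∀ t : ℝ, HasDerivAt v (-(u t) + (u t) ^ (n + 1) / ((n : ℝ) + 1)) t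
  energy : ∀ t : ℝ, hamiltonian n (u t) (v t) = h
  period_pos : 0 < T
  periodic : ∀ t : ℝ, u (t + T) = u t ∧ v (t + T) = v t
  minimal : ∀ t : ℝ, 0 < t → t < T → ¬ (u t = u 0 ∧ v t = v 0)

/-- The line integral `∮ f(u, v) du` along the closed curve `t ↦ (u t, v t)`, `0 ≤ t ≤ T`. -/
def loopIntegral (f : ℝ → ℝ → ℝ) (u v : ℝ → ℝ) (T : ℝ) : ℝ :=
  ∫ t in (0 : ℝ)..T, f (u t) (v t) * deriv u t

/-- The Abelian integral `∮ u ^ k v du` along the closed curve `t ↦ (u t, v t)`, `0 ≤ t ≤ T`. -/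
def abelianIntegral (k : ℕ) (u v : ℝ → ℝ) (T : ℝ) : ℝ :=
  loopIntegral (fun x y => x ^ k * y) u v T

/-- The ratio `(∮ u ^ n v du) / (∮ v du)` as a function of `h`, for a family of closed curves
`t ↦ (u h t, v h t)`, `0 ≤ t ≤ T h`. -/
def abelianRatio (n : ℕ) (u v : ℝ → ℝ → ℝ) (T : ℝ → ℝ) (h : ℝ) : ℝ :=
  abelianIntegral n (u h) (v h) (T h) / abelianIntegral 0 (u h) (v h) (T h)

end AbelianRatio

end

/-! The substitution `x = energyRoot n u` turns the level `H = h` into the circle `x² + v² = ρ²`, `ρ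
= √(2h)`. With `x = ρ sin θ`, `v = ρ cos θ`, the integral of `u ^ k v du` becomes `M_k(ρ) = ρ² ∫
w_k(ρ sin θ) cos² θ dθ`, where `w_k = u ^ k du/dx` (`IsPeriodicOrbit.abelianIntegral_eq`). Its
derivative is `M_k' = ρ ∫ w_k(ρ sin θ) dθ` (`hasDerivAt_circleMoment`), so `(M_n / M_0)' > 0`
amounts to `∫ w_n cos² · ∫ w_0 < ∫ w_n · ∫ w_0 cos²` (`integral_weight_mul_lt`).

Only the even parts of the weights count, and `cos² θ` decreases in `|sin θ|`. So Chebyshev's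
inequality (`integral_mul_cos_sq_mul_lt`) gives the claim once the quotient of the even parts of
`w_n` and `w_0` increases on `x ≥ 0` (`evenWeight_mul_lt`). For even `n` this quotient is `u ^ n`.
For odd `n`, let `p` and `-r` be the abscissas at `x` and `-x`: the quotient is `ratioNum /
ratioDen`, with numerator increasing and denominator decreasing because `p`, `r` and `p - r ≥ 0` all
grow with `x`. -/

namespace AbelianRatio

/-! ### The coordinate `x = energyRoot n u` and its inverse. -/

/-- The abscissa `(n + 1) ^ (1 / n)` of the saddle with positive abscissa. -/
noncomputable def saddle (n : ℕ) : ℝ := ((n : ℝ) + 1) ^ ((1 : ℝ) / (n : ℝ))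

/-- The square root of `2 W` which has the sign of `u`. -/
noncomputable def energyRoot (n : ℕ) (u : ℝ) : ℝ :=
  u * √(1 - 2 * u ^ n / (((n : ℝ) + 1) * ((n : ℝ) + 2)))

/-- The reciprocal of the derivative of `energyRoot`. -/
noncomputable def timeDensity (n : ℕ) (u : ℝ) : ℝ :=
  √(1 - 2 * u ^ n / (((n : ℝ) + 1) * ((n : ℝ) + 2))) / (1 - u ^ n / ((n : ℝ) + 1))

/-- The largest value `√(2 d_n)` of `energyRoot` between the saddles. -/
noncomputable def maxRadius (n : ℕ) : ℝ := √(2 * criticalEnergy n)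

/-- The inverse of `energyRoot` between the saddles. -/
noncomputable def position (n : ℕ) : ℝ → ℝ :=
  Function.invFunOn (energyRoot n) (Ioo (-saddle n) (saddle n))

theorem saddle_pos (n : ℕ) : 0 < saddle n := by
  unfold saddle; positivity

theorem saddle_pow {n : ℕ} (hn : 0 < n) : saddle n ^ n = n + 1 := by
  have hn' : (n : ℝ) ≠ 0 := by positivity
  rw [saddle, ← Real.rpow_natCast, ← Real.rpow_mul (by positivity), one_div_mul_cancel hn',
    Real.rpow_one]

theorem criticalEnergy_eq (n : ℕ) :
    criticalEnergy n = n * saddle n ^ 2 / (2 * (n + 2)) := by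
  rw [criticalEnergy, saddle, ← Real.rpow_natCast, ← Real.rpow_mul (by positivity)]
  congr 3
  push_cast
  ring

theorem criticalEnergy_pos {n : ℕ} (hn : 0 < n) : 0 < criticalEnergy n := by
  have := saddle_pos n
  have : (0 : ℝ) < n := by exact_mod_cast hn
  rw [criticalEnergy_eq]; positivity

theorem maxRadius_pos {n : ℕ} (hn : 0 < n) : 0 < maxRadius n :=
  Real.sqrt_pos.2 (by linarith [criticalEnergy_pos hn])

theorem pow_le_of_abs_le_saddle {n : ℕ} (hn : 0 < n) {u : ℝ} (hu : |u| ≤ saddle n) :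
    u ^ n ≤ n + 1 := by
  rw [← saddle_pow hn]
  exact (le_abs_self _).trans (by rw [abs_pow]; gcongr)

theorem pow_lt_of_abs_lt_saddle {n : ℕ} (hn : 0 < n) {u : ℝ} (hu : |u| < saddle n) :
    u ^ n < n + 1 := by
  rw [← saddle_pow hn]
  exact (le_abs_self _).trans_lt (by rw [abs_pow]; gcongr)

theorem radicand_pos {n : ℕ} (hn : 0 < n) {u : ℝ} (hu : |u| ≤ saddle n) :
    0 < 1 - 2 * u ^ n / (((n : ℝ) + 1) * ((n : ℝ) + 2)) := by
  have h := pow_le_of_abs_le_saddle hn hu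
  have hn' : (0 : ℝ) < n := by exact_mod_cast hn
  rw [sub_pos, div_lt_one (by positivity)]
  nlinarith

theorem one_sub_pow_div_pos {n : ℕ} (hn : 0 < n) {u : ℝ} (hu : |u| < saddle n) :
    0 < 1 - u ^ n / ((n : ℝ) + 1) := by
  have h := pow_lt_of_abs_lt_saddle hn hu
  rw [sub_pos, div_lt_one (by positivity)]
  exact h

theorem timeDensity_pos {n : ℕ} (hn : 0 < n) {u : ℝ} (hu : |u| < saddle n) :
    0 < timeDensity n u :=
  div_pos (Real.sqrt_pos.2 (radicand_pos hn hu.le)) (one_sub_pow_div_pos hn hu)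

theorem energyRoot_sq {n : ℕ} (hn : 0 < n) {u : ℝ} (hu : |u| ≤ saddle n) :
    energyRoot n u ^ 2 = 2 * potential n u := by
  rw [energyRoot, mul_pow, Real.sq_sqrt (radicand_pos hn hu).le, potential]
  ring

/-- Pulling the factor `u` out of the root keeps the radicand positive, so the center `u = 0` needs
no separate treatment. -/
theorem hasDerivAt_energyRoot {n : ℕ} (hn : 0 < n) {u : ℝ} (hu : |u| < saddle n) :
    HasDerivAt (energyRoot n) (timeDensity n u)⁻¹ u := by
  have hr := radicand_pos hn hu.le
  have hs := Real.sqrt_pos.2 hr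
  have hq := Real.sq_sqrt hr.le
  have hb := one_sub_pow_div_pos hn hu
  have h1 : HasDerivAt (fun u : ℝ => 1 - 2 * u ^ n / (((n : ℝ) + 1) * ((n : ℝ) + 2)))
      (-(2 * (n * u ^ (n - 1)) / (((n : ℝ) + 1) * ((n : ℝ) + 2)))) u :=
    (((hasDerivAt_pow n u).const_mul 2).div_const _).const_sub 1
  have h2 := (hasDerivAt_id u).mul (h1.sqrt hr.ne')
  refine h2.congr_deriv ?_
  have hp : u * u ^ (n - 1) = u ^ n := mul_pow_sub_one hn.ne' u
  rw [timeDensity, inv_div]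
  simp only [id]
  generalize √(1 - 2 * u ^ n / (((n : ℝ) + 1) * ((n : ℝ) + 2))) = s at hs hq
  rw [eq_div_iff hs.ne', add_mul, one_mul, ← pow_two, hq]
  field_simp
  linear_combination (-(n : ℝ)) * hp

theorem energyRoot_mul_inv_timeDensity {n : ℕ} (hn : 0 < n) {u : ℝ} (hu : |u| < saddle n) :
    energyRoot n u * (timeDensity n u)⁻¹ = u - u ^ (n + 1) / ((n : ℝ) + 1) := by
  have hs := Real.sqrt_pos.2 (radicand_pos hn hu.le)
  rw [timeDensity, inv_div, energyRoot, mul_assoc, mul_div_cancel₀ _ hs.ne']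
  ring

theorem continuous_energyRoot (n : ℕ) : Continuous (energyRoot n) := by
  unfold energyRoot; fun_prop

theorem strictMonoOn_energyRoot {n : ℕ} (hn : 0 < n) :
    StrictMonoOn (energyRoot n) (Icc (-saddle n) (saddle n)) := by
  refine strictMonoOn_of_deriv_pos (convex_Icc _ _) (continuous_energyRoot n).continuousOn ?_
  intro x hx
  rw [interior_Icc] at hx
  have hx := abs_lt.2 hx
  rw [(hasDerivAt_energyRoot hn hx).deriv]
  exact inv_pos.2 (timeDensity_pos hn hx)

theorem potential_saddle {n : ℕ} (hn : 0 < n) : potential n (saddle n) = criticalEnergy n := by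
  rw [potential, criticalEnergy_eq, pow_add, saddle_pow hn]
  field_simp
  ring

/-- For odd `n` the point `-saddle n` is not an equilibrium, but the sign of `u ^ n` only raises the
potential there. It is therefore a barrier for all energies below the critical one, whatever the
parity. -/
theorem criticalEnergy_le_potential_neg_saddle {n : ℕ} (hn : 0 < n) :
    criticalEnergy n ≤ potential n (-saddle n) := by
  have h : (-saddle n) ^ n ≤ saddle n ^ n :=
    (le_abs_self _).trans (by rw [abs_pow, abs_neg, abs_of_pos (saddle_pos n)])
  rw [← potential_saddle hn, potential, potential, pow_add, pow_add, neg_sq]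
  gcongr

theorem energyRoot_saddle {n : ℕ} (hn : 0 < n) : energyRoot n (saddle n) = maxRadius n := by
  have h := energyRoot_sq hn (abs_of_pos (saddle_pos n)).le
  rw [potential_saddle hn] at h
  rw [maxRadius, ← h, Real.sqrt_sq]
  exact mul_nonneg (saddle_pos n).le (Real.sqrt_nonneg _)

theorem energyRoot_neg_saddle_le {n : ℕ} (hn : 0 < n) :
    energyRoot n (-saddle n) ≤ -maxRadius n := by
  have h := energyRoot_sq hn (u := -saddle n) (by rw [abs_neg, abs_of_pos (saddle_pos n)])
  have h' := criticalEnergy_le_potential_neg_saddle hn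
  have h0 : energyRoot n (-saddle n) ≤ 0 :=
    mul_nonpos_of_nonpos_of_nonneg (neg_nonpos.2 (saddle_pos n).le) (Real.sqrt_nonneg _)
  rw [le_neg, maxRadius]
  exact Real.sqrt_le_iff.2 ⟨by linarith, by rw [neg_sq]; linarith⟩

theorem surjOn_energyRoot {n : ℕ} (hn : 0 < n) :
    SurjOn (energyRoot n) (Ioo (-saddle n) (saddle n)) (Ioo (-maxRadius n) (maxRadius n)) := by
  intro x hx
  refine intermediate_value_Ioo (by linarith [saddle_pos n])
    (continuous_energyRoot n).continuousOn ⟨?_, ?_⟩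
  · exact (energyRoot_neg_saddle_le hn).trans_lt hx.1
  · rw [energyRoot_saddle hn]; exact hx.2

theorem abs_position_lt {n : ℕ} (hn : 0 < n) {x : ℝ} (hx : |x| < maxRadius n) :
    |position n x| < saddle n :=
  abs_lt.2 (Function.invFunOn_mem (surjOn_energyRoot hn (abs_lt.1 hx)))

theorem energyRoot_position {n : ℕ} (hn : 0 < n) {x : ℝ} (hx : |x| < maxRadius n) :
    energyRoot n (position n x) = x :=
  Function.invFunOn_eq (surjOn_energyRoot hn (abs_lt.1 hx))

theorem position_energyRoot {n : ℕ} (hn : 0 < n) {u : ℝ} (hu : |u| < saddle n) :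
    position n (energyRoot n u) = u :=
  ((strictMonoOn_energyRoot hn).injOn.mono Ioo_subset_Icc_self).leftInvOn_invFunOn (abs_lt.1 hu)

theorem strictMonoOn_position {n : ℕ} (hn : 0 < n) :
    StrictMonoOn (position n) (Ioo (-maxRadius n) (maxRadius n)) := by
  intro x hx y hy hxy
  have hx := abs_lt.2 hx
  have hy := abs_lt.2 hy
  rw [← energyRoot_position hn hx, ← energyRoot_position hn hy] at hxy
  exact ((strictMonoOn_energyRoot hn).lt_iff_lt
    (Ioo_subset_Icc_self (abs_lt.1 (abs_position_lt hn hx)))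
    (Ioo_subset_Icc_self (abs_lt.1 (abs_position_lt hn hy)))).1 hxy

theorem position_zero {n : ℕ} (hn : 0 < n) : position n 0 = 0 := by
  have h := position_energyRoot hn (u := 0) (by simpa using saddle_pos n)
  simpa [energyRoot] using h

theorem continuousAt_position {n : ℕ} (hn : 0 < n) {x : ℝ} (hx : |x| < maxRadius n) :
    ContinuousAt (position n) x := by
  refine (strictMonoOn_position hn).continuousAt_of_image_mem_nhds
    (isOpen_Ioo.mem_nhds (abs_lt.1 hx)) ?_
  have hopen : IsOpen (Ioo (-saddle n) (saddle n) ∩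
      energyRoot n ⁻¹' Ioo (-maxRadius n) (maxRadius n)) :=
    isOpen_Ioo.inter (isOpen_Ioo.preimage (continuous_energyRoot n))
  refine mem_of_superset (hopen.mem_nhds ⟨abs_lt.1 (abs_position_lt hn hx), ?_⟩) ?_
  · rw [mem_preimage, energyRoot_position hn hx]; exact abs_lt.1 hx
  · exact fun u hu => ⟨energyRoot n u, hu.2, position_energyRoot hn (abs_lt.2 hu.1)⟩

theorem hasDerivAt_position {n : ℕ} (hn : 0 < n) {x : ℝ} (hx : |x| < maxRadius n) :
    HasDerivAt (position n) (timeDensity n (position n x)) x := by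
  have hu := abs_position_lt hn hx
  rw [← inv_inv (timeDensity n (position n x))]
  refine (hasDerivAt_energyRoot hn hu).of_local_left_inverse (continuousAt_position hn hx)
    (inv_ne_zero (timeDensity_pos hn hu).ne') ?_
  filter_upwards [isOpen_Ioo.mem_nhds (abs_lt.1 hx)] with y hy
  exact energyRoot_position hn (abs_lt.2 hy)

theorem continuousAt_timeDensity {n : ℕ} (hn : 0 < n) {u : ℝ} (hu : |u| < saddle n) :
    ContinuousAt (timeDensity n) u := by
  unfold timeDensity
  have := (one_sub_pow_div_pos hn hu).ne'
  fun_prop (disch := assumption)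

theorem position_pos {n : ℕ} (hn : 0 < n) {x : ℝ} (h0 : 0 < x) (hx : |x| < maxRadius n) :
    0 < position n x := by
  have h := strictMonoOn_position hn (a := 0) (by simpa using maxRadius_pos hn) (abs_lt.1 hx) h0
  rwa [position_zero hn] at h

theorem position_neg {n : ℕ} (hn : 0 < n) {x : ℝ} (h0 : x < 0) (hx : |x| < maxRadius n) :
    position n x < 0 := by
  have h := strictMonoOn_position hn (b := 0) (abs_lt.1 hx) (by simpa using maxRadius_pos hn) h0
  rwa [position_zero hn] at h

/-- This is `W'(u) du = x dx`, the differential of `2 W(u) = x²`; it lets the densities at `x` and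
`-x` be compared through `W'`. -/
theorem mul_timeDensity_position {n : ℕ} (hn : 0 < n) {x : ℝ} (hx : |x| < maxRadius n) :
    (position n x - position n x ^ (n + 1) / ((n : ℝ) + 1)) * timeDensity n (position n x) = x := by
  have hu := abs_position_lt hn hx
  rw [← energyRoot_mul_inv_timeDensity hn hu, energyRoot_position hn hx,
    inv_mul_cancel_right₀ (timeDensity_pos hn hu).ne']

theorem two_mul_potential_position {n : ℕ} (hn : 0 < n) {x : ℝ} (hx : |x| < maxRadius n) :
    2 * potential n (position n x) = x ^ 2 := by
  rw [← energyRoot_sq hn (abs_position_lt hn hx).le, energyRoot_position hn hx]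

/-! ### Even parts of the weights and monotonicity of their quotient. -/

/-- The weight `u ^ k du / dx`, where `u = position n x`. -/
noncomputable def weight (n k : ℕ) (x : ℝ) : ℝ :=
  position n x ^ k * timeDensity n (position n x)

/-- The sum of the values of `weight n k` at `x` and `-x`. -/
noncomputable def evenWeight (n k : ℕ) (x : ℝ) : ℝ :=
  weight n k x + weight n k (-x)

theorem evenWeight_zero_pos {n : ℕ} (hn : 0 < n) {x : ℝ} (hx : |x| < maxRadius n) :
    0 < evenWeight n 0 x := by
  have h1 := timeDensity_pos hn (abs_position_lt hn hx)
  have h2 := timeDensity_pos hn (abs_position_lt hn (x := -x) (by rwa [abs_neg]))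
  simp only [evenWeight, weight, pow_zero, one_mul]
  exact add_pos h1 h2

theorem position_neg_of_even {n : ℕ} (hn : 0 < n) (he : Even n) {x : ℝ} (hx : |x| < maxRadius n) :
    position n (-x) = -position n x := by
  have hu := abs_position_lt hn hx
  have h : energyRoot n (-position n x) = -x := by
    nth_rw 2 [← energyRoot_position hn hx]
    simp only [energyRoot, he.neg_pow, neg_mul]
  rw [← h, position_energyRoot hn (by rwa [abs_neg])]

/-- For odd `n` the hypothesis is `W(p) = W(-r)` and the conclusion is `W'(p) ≤ |W'(-r)|`.
Multiplying by `(n + 2)(p + r)` makes the left side `2 (p ^ (n + 2) + r ^ (n + 2))`, and `2 ≤ n + 2`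
suffices. -/
theorem sub_le_of_odd {n : ℕ} {p r : ℝ} (hp : 0 < p) (hr : 0 < r)
    (h : (p ^ 2 - r ^ 2) / 2 = (p ^ (n + 2) + r ^ (n + 2)) / (((n : ℝ) + 1) * ((n : ℝ) + 2))) :
    ((n : ℝ) + 1) * (p - r) ≤ p ^ (n + 1) + r ^ (n + 1) := by
  have h1 : ((n : ℝ) + 1) * (p - r) * ((n + 2) * (p + r)) = 2 * (p ^ (n + 2) + r ^ (n + 2)) := by
    field_simp at h
    linear_combination h
  refine le_of_mul_le_mul_right ?_ (show 0 < ((n : ℝ) + 2) * (p + r) by positivity)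
  rw [h1]
  have h2 : p ^ (n + 2) + r ^ (n + 2) ≤ (p ^ (n + 1) + r ^ (n + 1)) * (p + r) := by
    have : 0 ≤ p ^ (n + 1) * r + r ^ (n + 1) * p := by positivity
    rw [pow_succ p (n + 1), pow_succ r (n + 1)]
    linarith
  have h3 : 0 ≤ (p ^ (n + 1) + r ^ (n + 1)) * (p + r) := by positivity
  have h4 : (0 : ℝ) ≤ n := n.cast_nonneg
  nlinarith

/-- Since `du/dx = x / W'(u)`, the side where the potential is less steep has the larger density. -/
theorem timeDensity_position_neg_le {n : ℕ} (hn : 0 < n) (ho : Odd n) {x : ℝ} (h0 : 0 < x)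
    (hx : |x| < maxRadius n) :
    timeDensity n (position n (-x)) ≤ timeDensity n (position n x) := by
  have hx' : |-x| < maxRadius n := by rwa [abs_neg]
  have hp := position_pos hn h0 hx
  have hr := position_neg hn (neg_lt_zero.2 h0) hx'
  have e1 := mul_timeDensity_position hn hx
  have e2 := mul_timeDensity_position hn hx'
  have w1 := two_mul_potential_position hn hx
  have w2 := two_mul_potential_position hn hx'
  have t1 := timeDensity_pos hn (abs_position_lt hn hx)
  have t2 := timeDensity_pos hn (abs_position_lt hn hx')
  generalize timeDensity n (position n x) = s at *
  generalize timeDensity n (position n (-x)) = t at *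
  generalize position n x = p at *
  obtain ⟨r, hr'⟩ : ∃ r, position n (-x) = -r := ⟨_, (neg_neg _).symm⟩
  rw [hr'] at hr e2 w2
  rw [neg_lt_zero] at hr
  rw [ho.add_one.neg_pow] at e2
  have ho2 : Odd (n + 2) := by rw [Nat.odd_add]; simpa using ho
  rw [potential, ho2.neg_pow] at w2
  rw [potential] at w1
  have key := sub_le_of_odd (n := n) hp hr (by
    rw [add_div]
    linear_combination (w1 - w2) / 2 - neg_div (((n : ℝ) + 1) * ((n : ℝ) + 2)) (r ^ (n + 2)))
  have hm : (0 : ℝ) < n + 1 := by positivity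
  have key2 : p - p ^ (n + 1) / ((n : ℝ) + 1) ≤ r + r ^ (n + 1) / ((n : ℝ) + 1) := by
    rw [← sub_nonneg]
    have : r + r ^ (n + 1) / ((n : ℝ) + 1) - (p - p ^ (n + 1) / ((n : ℝ) + 1)) =
      (p ^ (n + 1) + r ^ (n + 1) - ((n : ℝ) + 1) * (p - r)) / ((n : ℝ) + 1) := by
      field_simp
      ring
    rw [this]
    exact div_nonneg (by linarith) hm.le
  have hb : 0 < r + r ^ (n + 1) / ((n : ℝ) + 1) := by positivity
  refine le_of_mul_le_mul_left ?_ hb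
  calc (r + r ^ (n + 1) / ((n : ℝ) + 1)) * t = x := by linear_combination -e2
    _ = (p - p ^ (n + 1) / ((n : ℝ) + 1)) * s := e1.symm
    _ ≤ _ := by gcongr

theorem monotoneOn_position_add {n : ℕ} (hn : 0 < n) (ho : Odd n) :
    MonotoneOn (fun x => position n x + position n (-x)) (Ico 0 (maxRadius n)) := by
  have hd : ∀ x, |x| < maxRadius n → HasDerivAt (fun x => position n x + position n (-x))
      (timeDensity n (position n x) - timeDensity n (position n (-x))) x := by
    intro x hx
    have h2 := (hasDerivAt_position hn (x := -x) (by rwa [abs_neg])).scomp x (hasDerivAt_neg x)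
    refine ((hasDerivAt_position hn hx).add h2).congr_deriv ?_
    simp [sub_eq_add_neg]
  refine monotoneOn_of_deriv_nonneg (convex_Ico _ _) ?_ ?_ ?_
  · intro x hx
    exact (hd x (by rw [abs_of_nonneg hx.1]; exact hx.2)).continuousAt.continuousWithinAt
  · intro x hx
    rw [interior_Ico] at hx
    exact (hd x (by rw [abs_of_pos hx.1]; exact hx.2)).differentiableAt.differentiableWithinAt
  · intro x hx
    rw [interior_Ico] at hx
    have hx' : |x| < maxRadius n := by rw [abs_of_pos hx.1]; exact hx.2
    rw [(hd x hx').deriv, sub_nonneg]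
    exact timeDensity_position_neg_le hn ho hx.1 hx'

/-- The quotient `(p ^ (2 k) - r ^ (2 k)) / (p ^ 2 - r ^ 2)` as a polynomial. -/
noncomputable def evenGeomSum (k : ℕ) (p r : ℝ) : ℝ :=
  ∑ i ∈ Finset.range k, (p ^ 2) ^ i * (r ^ 2) ^ (k - 1 - i)

theorem evenGeomSum_mul (k : ℕ) (p r : ℝ) :
    evenGeomSum k p r * (p ^ 2 - r ^ 2) = p ^ (2 * k) - r ^ (2 * k) := by
  rw [evenGeomSum, geom_sum₂_mul, pow_mul, pow_mul]

theorem evenGeomSum_nonneg (k : ℕ) (p r : ℝ) : 0 ≤ evenGeomSum k p r :=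
  Finset.sum_nonneg fun _ _ => by positivity

theorem evenGeomSum_le (k : ℕ) {p r p' r' : ℝ} (hp : 0 ≤ p) (hr : 0 ≤ r) (hpp : p ≤ p')
    (hrr : r ≤ r') : evenGeomSum k p r ≤ evenGeomSum k p' r' := by
  unfold evenGeomSum
  gcongr

/-- Numerator of the ratio of the even weights for odd `n = 2 k + 1`. -/
noncomputable def ratioNum (k : ℕ) (p r : ℝ) : ℝ :=
  p * r * ((2 * k + 2) * ((p - r) * evenGeomSum k p r) + (p * r) ^ (2 * k))

/-- Denominator of the ratio of the even weights for odd `n = 2 k + 1`. -/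
noncomputable def ratioDen (k : ℕ) (p r : ℝ) : ℝ :=
  2 * k + 2 - (p - r) * evenGeomSum (k + 1) p r

/-- Substituting `s = x / A` and `t = x / B` gives the quotient `(p ^ n B - r ^ n A) / (A + B)` with
`n = 2 k + 1`. Both parts, times `2 k + 2`, are divisible by `p + r`; cancelling it leaves
expressions whose monotonicity in `p`, `r` and `p - r` is visible. -/
theorem ratioNum_identity (k : ℕ) (p r s t x : ℝ) (hp : 0 < p) (hr : 0 < r) (hs : 0 < s)
    (ht : 0 < t) (hx : 0 < x)
    (e1 : (p - p ^ (2 * k + 2) / (2 * k + 2)) * s = x)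
    (e2 : (r + r ^ (2 * k + 2) / (2 * k + 2)) * t = x) :
    0 < ratioDen k p r ∧
    (p ^ (2 * k + 1) * s - r ^ (2 * k + 1) * t) * ratioDen k p r = ratioNum k p r * (s + t) := by
  have hm : (0 : ℝ) < 2 * k + 2 := by positivity
  set A := p - p ^ (2 * k + 2) / (2 * k + 2) with hA
  set B := r + r ^ (2 * k + 2) / (2 * k + 2) with hB
  have hA0 : 0 < A := (mul_pos_iff_of_pos_right hs).1 (e1 ▸ hx)
  have hB0 : 0 < B := by positivity
  have g1 := evenGeomSum_mul k p r
  have g2 := evenGeomSum_mul (k + 1) p r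
  have hpr : 0 < p + r := by positivity
  have hD : (p + r) * ratioDen k p r = (2 * k + 2) * (A + B) := by
    rw [ratioDen, hA, hB]
    field_simp
    rw [mul_add, mul_one] at g2
    linear_combination -g2
  have hN : (p + r) * ratioNum k p r =
      (2 * k + 2) * (p ^ (2 * k + 1) * B - r ^ (2 * k + 1) * A) := by
    rw [ratioNum, hA, hB, mul_pow]
    field_simp
    linear_combination (2 * k + 2) * p * r * g1
  refine ⟨(mul_pos_iff_of_pos_left hpr).1 (hD ▸ by positivity), ?_⟩
  have hs' : s = x / A := by rw [← e1]; field_simp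
  have ht' : t = x / B := by rw [← e2]; field_simp
  refine mul_left_cancel₀ hpr.ne' ?_
  calc _ = (p ^ (2 * k + 1) * s - r ^ (2 * k + 1) * t) * ((p + r) * ratioDen k p r) := by ring
    _ = ((p + r) * ratioNum k p r) * (s + t) := by
      rw [hD, hN, hs', ht']
      field_simp
      ring
    _ = _ := by ring

theorem ratioNum_lt (k : ℕ) {p r p' r' : ℝ} (hp : 0 < p) (hr : 0 < r) (hpp : p < p')
    (hrr : r < r') (h0 : 0 ≤ p - r) (hd : p - r ≤ p' - r') : ratioNum k p r < ratioNum k p' r' := by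
  have h1 := evenGeomSum_le k hp.le hr.le hpp.le hrr.le
  have h2 := evenGeomSum_nonneg k p r
  have hp' := hp.trans hpp
  have hr' := hr.trans hrr
  have h3 : p * r < p' * r' := by gcongr
  unfold ratioNum
  have h4 : 0 < (2 * k + 2) * ((p - r) * evenGeomSum k p r) + (p * r) ^ (2 * k) := by positivity
  refine mul_lt_mul h3 ?_ h4 (by positivity)
  gcongr
  exact h0.trans hd

theorem ratioDen_le (k : ℕ) {p r p' r' : ℝ} (hp : 0 < p) (hr : 0 < r) (hpp : p < p')
    (hrr : r < r') (h0 : 0 ≤ p - r) (hd : p - r ≤ p' - r') : ratioDen k p' r' ≤ ratioDen k p r := by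
  have h1 := evenGeomSum_le (k + 1) hp.le hr.le hpp.le hrr.le
  have h2 := evenGeomSum_nonneg (k + 1) p r
  unfold ratioDen
  gcongr
  exact h0.trans hd

theorem evenWeight_eq_of_even {n : ℕ} (hn : 0 < n) (he : Even n) {x : ℝ}
    (hx : |x| < maxRadius n) : evenWeight n n x = position n x ^ n * evenWeight n 0 x := by
  simp only [evenWeight, weight, position_neg_of_even hn he hx, he.neg_pow]
  ring

theorem evenWeight_mul_of_odd (k : ℕ) {x : ℝ} (h0 : 0 < x) (hx : |x| < maxRadius (2 * k + 1)) :
    0 < ratioDen k (position (2 * k + 1) x) (-position (2 * k + 1) (-x)) ∧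
    evenWeight (2 * k + 1) (2 * k + 1) x *
      ratioDen k (position (2 * k + 1) x) (-position (2 * k + 1) (-x)) =
    ratioNum k (position (2 * k + 1) x) (-position (2 * k + 1) (-x)) *
      evenWeight (2 * k + 1) 0 x := by
  have hn : 0 < 2 * k + 1 := by omega
  have hx' : |-x| < maxRadius (2 * k + 1) := by rwa [abs_neg]
  have e1 := mul_timeDensity_position hn hx
  have e2 := mul_timeDensity_position hn hx'
  have ho : Odd (2 * k + 1) := odd_two_mul_add_one k
  have key := ratioNum_identity k (position (2 * k + 1) x) (-position (2 * k + 1) (-x)) _ _ x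
    (position_pos hn h0 hx) (neg_pos.2 (position_neg hn (neg_lt_zero.2 h0) hx'))
    (timeDensity_pos hn (abs_position_lt hn hx)) (timeDensity_pos hn (abs_position_lt hn hx')) h0
    (by push_cast at e1; rw [add_assoc, add_assoc] at e1; norm_num at e1; exact e1)
    (by
      push_cast at e2; rw [add_assoc, add_assoc] at e2; norm_num at e2
      have he : Even (2 * k + 2) := ⟨k + 1, by ring⟩
      rw [he.neg_pow]
      linear_combination -e2)
  refine ⟨key.1, ?_⟩
  rw [ho.neg_pow] at key
  simp only [evenWeight, weight, pow_zero, one_mul]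
  rw [← key.2]
  ring

theorem ratioNum_pos (k : ℕ) {p r : ℝ} (hp : 0 < p) (hr : 0 < r) (h : 0 ≤ p - r) :
    0 < ratioNum k p r := by
  have := evenGeomSum_nonneg k p r
  unfold ratioNum
  positivity

theorem neg_position_neg_le {n : ℕ} (hn : 0 < n) (ho : Odd n) {x : ℝ} (h0 : 0 ≤ x)
    (hx : x < maxRadius n) : 0 ≤ position n x - -position n (-x) := by
  have h := monotoneOn_position_add hn ho (a := 0) ⟨le_rfl, maxRadius_pos hn⟩ ⟨h0, hx⟩ h0
  simp only [neg_zero, position_zero hn, add_zero] at h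
  linarith

theorem evenWeight_pos {n : ℕ} (hn : 0 < n) {x : ℝ} (h0 : 0 < x) (hx : x < maxRadius n) :
    0 < evenWeight n n x := by
  have hx' : |x| < maxRadius n := by rwa [abs_of_pos h0]
  have hX := evenWeight_zero_pos hn hx'
  have hp := position_pos hn h0 hx'
  rcases Nat.even_or_odd n with he | ho
  · rw [evenWeight_eq_of_even hn he hx']
    positivity
  · have hr := neg_pos.2 (position_neg hn (neg_lt_zero.2 h0) (by rwa [abs_neg]))
    have hpr := neg_position_neg_le hn ho h0.le hx
    obtain ⟨k, rfl⟩ := ho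
    obtain ⟨d, e⟩ := evenWeight_mul_of_odd k h0 hx'
    exact (mul_pos_iff_of_pos_right d).1 (e ▸ mul_pos (ratioNum_pos k hp hr hpr) hX)

theorem evenWeight_mul_lt {n : ℕ} (hn : 0 < n) {x y : ℝ} (h0 : 0 ≤ x) (hxy : x < y)
    (hy : y < maxRadius n) :
    evenWeight n n x * evenWeight n 0 y < evenWeight n n y * evenWeight n 0 x := by
  rcases h0.eq_or_lt with rfl | h0
  -- At `x = 0` the left side vanishes because `position n 0 = 0` and `n > 0`; the factorization for
  -- odd `n` requires `x > 0`.
  · have h1 := evenWeight_zero_pos hn (x := 0) (by simpa using maxRadius_pos hn)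
    have h2 := mul_pos (evenWeight_pos hn hxy hy) h1
    simpa [evenWeight, weight, position_zero hn, hn.ne'] using h2
  have hx' : |x| < maxRadius n := by rw [abs_of_pos h0]; exact hxy.trans hy
  have hy' : |y| < maxRadius n := by rw [abs_of_pos (h0.trans hxy)]; exact hy
  have hx'' : |-x| < maxRadius n := by rwa [abs_neg]
  have hy'' : |-y| < maxRadius n := by rwa [abs_neg]
  have hX := evenWeight_zero_pos hn hx'
  have hY := evenWeight_zero_pos hn hy'
  have hp := position_pos hn h0 hx'
  have hpp := strictMonoOn_position hn (abs_lt.1 hx') (abs_lt.1 hy') hxy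
  rcases Nat.even_or_odd n with he | ho
  · rw [evenWeight_eq_of_even hn he hx', evenWeight_eq_of_even hn he hy', mul_assoc, mul_assoc,
      mul_comm (evenWeight n 0 x)]
    gcongr
  · have hr := neg_pos.2 (position_neg hn (neg_lt_zero.2 h0) hx'')
    have hrr := neg_lt_neg (strictMonoOn_position hn (abs_lt.1 hy'') (abs_lt.1 hx'')
      (neg_lt_neg hxy))
    have hmono := monotoneOn_position_add hn ho
    have m1 := neg_position_neg_le hn ho h0.le (hxy.trans hy)
    have m2 := hmono ⟨h0.le, hxy.trans hy⟩ ⟨(h0.trans hxy).le, hy⟩ hxy.le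
    simp only at m2
    obtain ⟨k, rfl⟩ := ho
    have ex := evenWeight_mul_of_odd k h0 hx'
    have ey := evenWeight_mul_of_odd k (h0.trans hxy) hy'
    have hN := ratioNum_lt k hp hr hpp hrr m1 (by linarith)
    have hD := ratioDen_le k hp hr hpp hrr m1 (by linarith)
    obtain ⟨dx, ex⟩ := ex
    obtain ⟨dy, ey⟩ := ey
    have hNp := (ratioNum_pos k hp hr m1).le
    rw [eq_div_of_mul_eq dx.ne' ex, eq_div_of_mul_eq dy.ne' ey, div_mul_eq_mul_div,
      div_mul_eq_mul_div, mul_assoc, mul_assoc, mul_comm (evenWeight _ 0 x),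
      div_lt_div_iff₀ dx dy]
    have hXY := mul_pos hY hX
    calc _ ≤ ratioNum k (position (2 * k + 1) x) (-position (2 * k + 1) (-x)) *
          (evenWeight (2 * k + 1) 0 y * evenWeight (2 * k + 1) 0 x) *
          ratioDen k (position (2 * k + 1) x) (-position (2 * k + 1) (-x)) := by gcongr
      _ < _ := by gcongr

/-! ### Moments on the circle and their derivative in the radius. -/

theorem abs_mul_sin_lt {R ρ : ℝ} (hρ : |ρ| < R) (θ : ℝ) : |ρ * Real.sin θ| < R := by
  rw [abs_mul]
  exact (mul_le_of_le_one_right (abs_nonneg _) (Real.abs_sin_le_one θ)).trans_lt hρ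

theorem continuous_comp_mul_sin {G : ℝ → ℝ} {R ρ : ℝ} (hG : ∀ x, |x| < R → ContinuousAt G x)
    (hρ : |ρ| < R) : Continuous fun θ => G (ρ * Real.sin θ) := by
  refine continuous_iff_continuousAt.2 fun θ => ?_
  exact ContinuousAt.comp (f := fun θ => ρ * Real.sin θ) (hG _ (abs_mul_sin_lt hρ θ))
    (by fun_prop)

/-- The integral `∮ G(x) v dx` along the circle `(x, v) = (ρ sin θ, ρ cos θ)`. -/
noncomputable def circleMoment (G : ℝ → ℝ) (ρ : ℝ) : ℝ :=
  ∫ θ in (0 : ℝ)..(2 * Real.pi), G (ρ * Real.sin θ) * (ρ * Real.cos θ) ^ 2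

/-- Integration by parts replaces `G` by its primitive, so that the moment can be differentiated in
`ρ` with `G` merely continuous. -/
theorem circleMoment_eq_of_hasDerivAt {Γ G : ℝ → ℝ} {R ρ : ℝ}
    (hΓ : ∀ x, |x| < R → HasDerivAt Γ (G x) x) (hG : ∀ x, |x| < R → ContinuousAt G x)
    (hρ : |ρ| < R) :
    circleMoment G ρ = ρ * ∫ θ in (0 : ℝ)..(2 * Real.pi), Γ (ρ * Real.sin θ) * Real.sin θ := by
  have cG := continuous_comp_mul_sin hG hρ
  have cΓ := continuous_comp_mul_sin (fun x hx => (hΓ x hx).continuousAt) hρ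
  have c1 : Continuous fun θ => G (ρ * Real.sin θ) * (ρ * Real.cos θ) ^ 2 :=
    cG.mul (by fun_prop)
  have c2 : Continuous fun θ => ρ * (Γ (ρ * Real.sin θ) * Real.sin θ) :=
    (cΓ.mul Real.continuous_sin).const_mul ρ
  have hd : ∀ θ ∈ uIcc (0 : ℝ) (2 * Real.pi),
      HasDerivAt (fun θ => ρ * (Γ (ρ * Real.sin θ) * Real.cos θ))
        (G (ρ * Real.sin θ) * (ρ * Real.cos θ) ^ 2 - ρ * (Γ (ρ * Real.sin θ) * Real.sin θ)) θ := by
    intro θ _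
    have h1 := (hΓ _ (abs_mul_sin_lt hρ θ)).comp θ ((Real.hasDerivAt_sin θ).const_mul ρ)
    refine ((h1.mul (Real.hasDerivAt_cos θ)).const_mul ρ).congr_deriv ?_
    simp only [Function.comp]
    ring
  have hi := intervalIntegral.integral_eq_sub_of_hasDerivAt hd
    ((c1.sub c2).intervalIntegrable _ _)
  rw [intervalIntegral.integral_sub (c1.intervalIntegrable _ _) (c2.intervalIntegrable _ _),
    intervalIntegral.integral_const_mul] at hi
  simp only [Real.sin_two_pi, Real.cos_two_pi, Real.sin_zero, Real.cos_zero, sub_self] at hi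
  exact sub_eq_zero.1 hi

theorem hasDerivAt_circleMoment {Γ G : ℝ → ℝ} {R ρ : ℝ}
    (hΓ : ∀ x, |x| < R → HasDerivAt Γ (G x) x) (hG : ∀ x, |x| < R → ContinuousAt G x)
    (h0 : ρ ≠ 0) (hρ : |ρ| < R) :
    HasDerivAt (circleMoment G)
      (ρ * ∫ θ in (0 : ℝ)..(2 * Real.pi), G (ρ * Real.sin θ)) ρ := by
  -- A smaller radius gives a compact interval on which `G` is bounded, which supplies the
  -- dominating constant.
  obtain ⟨R', hR1, hR2⟩ := exists_between hρ
  have hcΓ := fun x hx => (hΓ x hx).continuousAt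
  have hopen : IsOpen {y : ℝ | |y| < R'} := isOpen_lt continuous_abs continuous_const
  have hnhds := hopen.mem_nhds hR1
  obtain ⟨C, hC⟩ := (isCompact_Icc (a := -R') (b := R')).exists_bound_of_continuousOn
    (f := G) (fun x hx => (hG x ((abs_le.2 hx).trans_lt hR2)).continuousWithinAt)
  have hC0 : 0 ≤ C := (norm_nonneg _).trans (hC ρ (abs_le.1 hR1.le))
  have hD : HasDerivAt (fun ρ => ∫ θ in (0 : ℝ)..(2 * Real.pi), Γ (ρ * Real.sin θ) * Real.sin θ)
      (∫ θ in (0 : ℝ)..(2 * Real.pi), G (ρ * Real.sin θ) * Real.sin θ * Real.sin θ) ρ := by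
    refine (intervalIntegral.hasDerivAt_integral_of_dominated_loc_of_deriv_le
      (F := fun ρ θ => Γ (ρ * Real.sin θ) * Real.sin θ)
      (F' := fun ρ θ => G (ρ * Real.sin θ) * Real.sin θ * Real.sin θ)
      (bound := fun _ => C) hnhds ?_ ?_ ?_ ?_ ?_ ?_).2
    · filter_upwards [hnhds] with y hy
      exact ((continuous_comp_mul_sin hcΓ (lt_trans hy hR2)).mul
        Real.continuous_sin).aestronglyMeasurable
    · exact ((continuous_comp_mul_sin hcΓ hρ).mul Real.continuous_sin).intervalIntegrable _ _
    · exact (((continuous_comp_mul_sin hG hρ).mul Real.continuous_sin).mul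
        Real.continuous_sin).aestronglyMeasurable
    · refine Eventually.of_forall fun θ _ y hy => ?_
      have h1 := hC _ (abs_le.1 (abs_mul_sin_lt hy θ).le)
      rw [norm_mul, norm_mul]
      have h2 : ‖Real.sin θ‖ ≤ 1 := Real.abs_sin_le_one θ
      calc _ ≤ C * 1 * 1 := by gcongr
        _ = C := by ring
    · exact intervalIntegrable_const
    · refine Eventually.of_forall fun θ _ y hy => ?_
      exact ((hΓ _ (abs_mul_sin_lt (lt_trans hy hR2) θ)).comp y
        ((hasDerivAt_id y).mul_const (Real.sin θ))).mul_const _ |>.congr_deriv (by simp)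
  have hprod := (hasDerivAt_id ρ).mul hD
  refine (hprod.congr_of_eventuallyEq ?_).congr_deriv ?_
  · filter_upwards [hnhds] with y hy
    simpa using circleMoment_eq_of_hasDerivAt hΓ hG (lt_trans hy hR2)
  have cG := continuous_comp_mul_sin hG hρ
  have c1 : Continuous fun θ => G (ρ * Real.sin θ) * (ρ * Real.cos θ) ^ 2 :=
    cG.mul (by fun_prop)
  have c2 : Continuous fun θ => ρ * ρ * (G (ρ * Real.sin θ) * Real.sin θ * Real.sin θ) :=
    ((cG.mul Real.continuous_sin).mul Real.continuous_sin).const_mul _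
  -- After multiplication by `ρ`, the undifferentiated term is again the moment, with integrand `ρ²
  -- G cos²`; it joins `ρ² G sin²` to give `ρ² G`.
  refine mul_left_cancel₀ h0 ?_
  simp only [id, one_mul]
  rw [mul_add, ← circleMoment_eq_of_hasDerivAt hΓ hG hρ, circleMoment, ← mul_assoc, ← mul_assoc,
    ← intervalIntegral.integral_const_mul, ← intervalIntegral.integral_const_mul,
    ← intervalIntegral.integral_add (c1.intervalIntegrable _ _) (c2.intervalIntegrable _ _)]
  refine intervalIntegral.integral_congr fun θ _ => ?_
  linear_combination (ρ ^ 2 * G (ρ * Real.sin θ)) * Real.sin_sq_add_cos_sq θ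

/-! ### Chebyshev's inequality and symmetrization. -/

/-- **Chebyshev's inequality** on the circle for the weights `cos ^ 2` and `F / E`, where `F / E`
is even and increases with the distance to `0`. -/
theorem integral_mul_cos_sq_mul_lt {E F : ℝ → ℝ} {R ρ : ℝ} (h0 : 0 < ρ) (hρ : ρ < R)
    (hE : ∀ x, |x| < R → ContinuousAt E x) (hF : ∀ x, |x| < R → ContinuousAt F x)
    (hpos : ∀ x, |x| < R → 0 < E x) (evE : ∀ x, E (-x) = E x) (evF : ∀ x, F (-x) = F x)
    (hlt : ∀ x y, 0 ≤ x → x < y → y < R → F x * E y < F y * E x) :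
    (∫ θ in (0 : ℝ)..(2 * Real.pi), F (ρ * Real.sin θ) * Real.cos θ ^ 2) *
      (∫ θ in (0 : ℝ)..(2 * Real.pi), E (ρ * Real.sin θ)) <
    (∫ θ in (0 : ℝ)..(2 * Real.pi), F (ρ * Real.sin θ)) *
      ∫ θ in (0 : ℝ)..(2 * Real.pi), E (ρ * Real.sin θ) * Real.cos θ ^ 2 := by
  have hρ' : |ρ| < R := by rwa [abs_of_pos h0]
  have cE := continuous_comp_mul_sin hE hρ'
  have cF := continuous_comp_mul_sin hF hρ'
  have cEc : Continuous fun θ => E (ρ * Real.sin θ) * Real.cos θ ^ 2 := cE.mul (by fun_prop)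
  have cFc : Continuous fun θ => F (ρ * Real.sin θ) * Real.cos θ ^ 2 := cF.mul (by fun_prop)
  have hpi := Real.pi_pos
  have hmem : Real.pi / 2 ∈ Icc 0 (2 * Real.pi) := ⟨by linarith, by linarith⟩
  have hp : ∀ θ, 0 < E (ρ * Real.sin θ) := fun θ => hpos _ (abs_mul_sin_lt hρ' θ)
  set I := ∫ θ in (0 : ℝ)..(2 * Real.pi), E (ρ * Real.sin θ) with hI
  set J := ∫ θ in (0 : ℝ)..(2 * Real.pi), E (ρ * Real.sin θ) * Real.cos θ ^ 2 with hJ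
  have hJ0 : 0 < J := by
    have h := intervalIntegral.integral_lt_integral_of_continuousOn_of_le_of_exists_lt
      (a := 0) (b := 2 * Real.pi) (f := fun _ => (0 : ℝ))
      (g := fun θ => E (ρ * Real.sin θ) * Real.cos θ ^ 2) (by linarith) continuousOn_const
      cEc.continuousOn (fun θ _ => mul_nonneg (hp θ).le (sq_nonneg _))
      ⟨0, left_mem_Icc.2 (by linarith), by simpa using hp 0⟩
    simpa using h
  have hJI : J < I := by
    refine intervalIntegral.integral_lt_integral_of_continuousOn_of_le_of_exists_lt
      (by linarith) cEc.continuousOn cE.continuousOn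
      (fun θ _ => mul_le_of_le_one_right (hp θ).le (Real.cos_sq_le_one θ))
      ⟨Real.pi / 2, hmem, ?_⟩
    rw [Real.cos_pi_div_two]
    simpa using hp (Real.pi / 2)
  have hI0 := hJ0.trans hJI
  -- `J / I` is the `E`-weighted mean of `cos²`, and `|sin θ| = s` is where `cos² θ` equals that
  -- mean.
  set s := √(1 - J / I) with hs
  have hk : J / I < 1 := (div_lt_one hI0).2 hJI
  have hk0 : 0 < J / I := div_pos hJ0 hI0
  have hs2 : s ^ 2 = 1 - J / I := Real.sq_sqrt (by linarith)
  have hs0 : 0 < s := Real.sqrt_pos.2 (by linarith)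
  have hs1 : s < 1 := by nlinarith
  have hx0 : 0 < ρ * s := mul_pos h0 hs0
  have hx1 : ρ * s < ρ := mul_lt_of_lt_one_right h0 hs1
  have habsE : ∀ x, E |x| = E x := fun x => by rcases abs_choice x with h | h <;> simp [h, evE]
  have habsF : ∀ x, F |x| = F x := fun x => by rcases abs_choice x with h | h <;> simp [h, evF]
  have hcs : ∀ θ, J / I - Real.cos θ ^ 2 = |Real.sin θ| ^ 2 - s ^ 2 := fun θ => by
    rw [sq_abs, hs2, Real.cos_sq']; ring
  -- Both factors change sign at `|sin θ| = s` and in the same direction, so `f ≥ 0`.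
  set f : ℝ → ℝ := fun θ => (F (ρ * Real.sin θ) * E (ρ * s) - F (ρ * s) * E (ρ * Real.sin θ)) *
    (J / I - Real.cos θ ^ 2) with hf
  have cf : Continuous f := ((cF.mul_const _).sub (cE.const_mul _)).mul (by fun_prop)
  have hf0 : ∀ θ, 0 ≤ f θ := by
    intro θ
    have e : |ρ * Real.sin θ| = ρ * |Real.sin θ| := by rw [abs_mul, abs_of_pos h0]
    simp only [hf, hcs]
    rw [← habsF (ρ * Real.sin θ), ← habsE (ρ * Real.sin θ), e]
    have hsin := Real.abs_sin_le_one θ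
    have hsin0 := abs_nonneg (Real.sin θ)
    rcases le_total s |Real.sin θ| with h | h
    · rcases h.eq_or_lt with h | h
      · simp [← h]
      · have h2 : ρ * s < ρ * |Real.sin θ| := by gcongr
        have := hlt _ _ hx0.le h2 ((mul_le_of_le_one_right h0.le hsin).trans_lt hρ)
        exact mul_nonneg (by linarith) (sub_nonneg.2 (by gcongr))
    · rcases h.eq_or_lt with h | h
      · simp [← h]
      · have h2 : ρ * |Real.sin θ| < ρ * s := by gcongr
        have := hlt _ _ (by positivity) h2 (hx1.trans hρ)
        exact mul_nonneg_of_nonpos_of_nonpos (by linarith) (sub_nonpos.2 (by gcongr))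
  have hfpos : 0 < ∫ θ in (0 : ℝ)..(2 * Real.pi), f θ := by
    have h := intervalIntegral.integral_lt_integral_of_continuousOn_of_le_of_exists_lt
      (a := 0) (b := 2 * Real.pi) (f := fun _ => (0 : ℝ))
      (g := f) (by linarith) continuousOn_const cf.continuousOn (fun θ _ => hf0 θ)
      ⟨Real.pi / 2, hmem, ?_⟩
    · simpa using h
    · simp only [hf, Real.sin_pi_div_two, Real.cos_pi_div_two, mul_one]
      have := hlt _ _ hx0.le hx1 hρ
      exact mul_pos (by linarith) (by simpa using hk0)
  have hfi : ∫ θ in (0 : ℝ)..(2 * Real.pi), f θ =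
      E (ρ * s) * (J / I * (∫ θ in (0 : ℝ)..(2 * Real.pi), F (ρ * Real.sin θ)) -
        ∫ θ in (0 : ℝ)..(2 * Real.pi), F (ρ * Real.sin θ) * Real.cos θ ^ 2) -
      F (ρ * s) * (J / I * I - J) := by
    generalize J / I = κ at hf
    have c1 : Continuous fun θ => E (ρ * s) *
        (κ * F (ρ * Real.sin θ) - F (ρ * Real.sin θ) * Real.cos θ ^ 2) :=
      ((cF.const_mul κ).sub cFc).const_mul _
    have c2 : Continuous fun θ => F (ρ * s) *
        (κ * E (ρ * Real.sin θ) - E (ρ * Real.sin θ) * Real.cos θ ^ 2) :=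
      ((cE.const_mul κ).sub cEc).const_mul _
    rw [hI, hJ]
    simp only [← intervalIntegral.integral_const_mul]
    rw [← intervalIntegral.integral_sub ((cF.const_mul κ).intervalIntegrable _ _)
        (cFc.intervalIntegrable _ _),
      ← intervalIntegral.integral_sub ((cE.const_mul κ).intervalIntegrable _ _)
        (cEc.intervalIntegrable _ _)]
    simp only [← intervalIntegral.integral_const_mul]
    rw [← intervalIntegral.integral_sub (c1.intervalIntegrable _ _) (c2.intervalIntegrable _ _)]
    refine intervalIntegral.integral_congr fun θ _ => ?_
    simp only [hf]
    ring
  -- By the choice of the mean, the term with the constant `F (ρ * s)` integrates to zero.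
  rw [hfi, div_mul_cancel₀ _ hI0.ne', sub_self, mul_zero, sub_zero] at hfpos
  have := (mul_pos_iff_of_pos_left (hpos _ (by rw [abs_of_pos hx0]; exact hx1.trans hρ))).1 hfpos
  rw [sub_pos, div_mul_eq_mul_div, lt_div_iff₀ hI0] at this
  linarith

/-- The shift `θ ↦ θ + π` changes the sign of `sin θ` and preserves `w`, so `G` and its reflection
have equal integrals. -/
theorem integral_comp_sin_symm {G : ℝ → ℝ} {R ρ : ℝ} (hG : ∀ x, |x| < R → ContinuousAt G x)
    (hρ : |ρ| < R) {w : ℝ → ℝ} (hw : Continuous w) (hwπ : Function.Periodic w Real.pi) :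
    ∫ θ in (0 : ℝ)..(2 * Real.pi), (G (ρ * Real.sin θ) + G (-(ρ * Real.sin θ))) * w θ =
      2 * ∫ θ in (0 : ℝ)..(2 * Real.pi), G (ρ * Real.sin θ) * w θ := by
  have c1 := continuous_comp_mul_sin hG hρ
  have c2 := continuous_comp_mul_sin (ρ := -ρ) hG (by rwa [abs_neg])
  simp only [neg_mul] at c2
  have hper : Function.Periodic (fun θ => G (ρ * Real.sin θ) * w θ) (2 * Real.pi) := by
    intro θ
    have : w (θ + 2 * Real.pi) = w θ := by
      rw [two_mul, ← add_assoc, hwπ, hwπ]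
    simp only [Real.sin_add_two_pi, this]
  have hshift : ∫ θ in (0 : ℝ)..(2 * Real.pi), G (-(ρ * Real.sin θ)) * w θ =
      ∫ θ in (0 : ℝ)..(2 * Real.pi), G (ρ * Real.sin θ) * w θ := by
    have h1 := intervalIntegral.integral_comp_add_right
      (fun θ => G (ρ * Real.sin θ) * w θ) (a := 0) (b := 2 * Real.pi) Real.pi
    have h2 := hper.intervalIntegral_add_eq Real.pi 0
    simp only [Real.sin_add_pi, mul_neg, hwπ _, zero_add] at h1 h2
    rw [h1, add_comm, h2]
  have c1w : Continuous fun θ => G (ρ * Real.sin θ) * w θ := c1.mul hw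
  have c2w : Continuous fun θ => G (-(ρ * Real.sin θ)) * w θ := c2.mul hw
  simp only [add_mul]
  rw [intervalIntegral.integral_add (c1w.intervalIntegrable _ _) (c2w.intervalIntegrable _ _),
    hshift]
  ring

/-! ### The ratio of the moments: derivative and limit at zero. -/

theorem continuousAt_weight {n : ℕ} (hn : 0 < n) (k : ℕ) {x : ℝ} (hx : |x| < maxRadius n) :
    ContinuousAt (weight n k) x :=
  ((continuousAt_position hn hx).pow k).mul
    (ContinuousAt.comp (f := position n) (continuousAt_timeDensity hn (abs_position_lt hn hx))
      (continuousAt_position hn hx))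

theorem continuousAt_evenWeight {n : ℕ} (hn : 0 < n) (k : ℕ) {x : ℝ} (hx : |x| < maxRadius n) :
    ContinuousAt (evenWeight n k) x :=
  (continuousAt_weight hn k hx).add
    (ContinuousAt.comp (f := fun x : ℝ => -x)
      (continuousAt_weight hn k (by rwa [abs_neg])) continuousAt_neg)

theorem hasDerivAt_position_pow {n : ℕ} (hn : 0 < n) (k : ℕ) {x : ℝ} (hx : |x| < maxRadius n) :
    HasDerivAt (fun x => position n x ^ (k + 1) / (k + 1)) (weight n k x) x := by
  refine (((hasDerivAt_position hn hx).pow (k + 1)).div_const ((k : ℝ) + 1)).congr_deriv ?_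
  have : (k : ℝ) + 1 ≠ 0 := by positivity
  rw [weight]
  push_cast
  field_simp

theorem weight_zero_pos {n : ℕ} (hn : 0 < n) {x : ℝ} (hx : |x| < maxRadius n) :
    0 < weight n 0 x := by
  rw [weight, pow_zero, one_mul]
  exact timeDensity_pos hn (abs_position_lt hn hx)

theorem circleMoment_eq (G : ℝ → ℝ) (ρ : ℝ) : circleMoment G ρ =
    ρ ^ 2 * ∫ θ in (0 : ℝ)..(2 * Real.pi), G (ρ * Real.sin θ) * Real.cos θ ^ 2 := by
  rw [circleMoment, ← intervalIntegral.integral_const_mul]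
  refine intervalIntegral.integral_congr fun θ _ => ?_
  ring

theorem circleMoment_weight_zero_pos {n : ℕ} (hn : 0 < n) {ρ : ℝ} (h0 : 0 < ρ)
    (hρ : ρ < maxRadius n) : 0 < circleMoment (weight n 0) ρ := by
  have hρ' : |ρ| < maxRadius n := by rwa [abs_of_pos h0]
  have c := continuous_comp_mul_sin (fun x hx => continuousAt_weight hn 0 hx) hρ'
  have c' : Continuous fun θ => weight n 0 (ρ * Real.sin θ) * (ρ * Real.cos θ) ^ 2 :=
    c.mul (by fun_prop)
  have hp : ∀ θ, 0 < weight n 0 (ρ * Real.sin θ) := fun θ =>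
    weight_zero_pos hn (abs_mul_sin_lt hρ' θ)
  have hpi : (0 : ℝ) < 2 * Real.pi := by linarith [Real.pi_pos]
  have h := intervalIntegral.integral_lt_integral_of_continuousOn_of_le_of_exists_lt
    (a := 0) (b := 2 * Real.pi) (f := fun _ => (0 : ℝ))
    (g := fun θ => weight n 0 (ρ * Real.sin θ) * (ρ * Real.cos θ) ^ 2) hpi continuousOn_const
    c'.continuousOn (fun θ _ => mul_nonneg (hp θ).le (sq_nonneg _))
    ⟨0, left_mem_Icc.2 hpi.le, mul_pos (hp 0) (by rw [Real.cos_zero]; positivity)⟩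
  simpa [circleMoment] using h

theorem integral_weight_mul_lt {n : ℕ} (hn : 0 < n) {ρ : ℝ} (h0 : 0 < ρ)
    (hρ : ρ < maxRadius n) :
    (∫ θ in (0 : ℝ)..(2 * Real.pi), weight n n (ρ * Real.sin θ) * Real.cos θ ^ 2) *
      (∫ θ in (0 : ℝ)..(2 * Real.pi), weight n 0 (ρ * Real.sin θ)) <
    (∫ θ in (0 : ℝ)..(2 * Real.pi), weight n n (ρ * Real.sin θ)) *
      ∫ θ in (0 : ℝ)..(2 * Real.pi), weight n 0 (ρ * Real.sin θ) * Real.cos θ ^ 2 := by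
  have hρ' : |ρ| < maxRadius n := by rwa [abs_of_pos h0]
  have h := integral_mul_cos_sq_mul_lt (E := evenWeight n 0) (F := evenWeight n n) h0 hρ
    (fun x hx => continuousAt_evenWeight hn 0 hx) (fun x hx => continuousAt_evenWeight hn n hx)
    (fun x hx => evenWeight_zero_pos hn hx) (fun x => by simp [evenWeight, add_comm])
    (fun x => by simp [evenWeight, add_comm]) (fun x y hx hxy hy => evenWeight_mul_lt hn hx hxy hy)
  have hcos : Function.Periodic (fun θ => Real.cos θ ^ 2) Real.pi := fun θ => by simp
  have e1 := fun k => integral_comp_sin_symm (fun x hx => continuousAt_weight hn k hx) hρ'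
    (w := fun θ => Real.cos θ ^ 2) (by fun_prop) hcos
  have e2 := fun k => integral_comp_sin_symm (fun x hx => continuousAt_weight hn k hx) hρ'
    (w := fun _ => 1) continuous_const (fun _ => rfl)
  simp only [mul_one] at e2
  simp only [evenWeight, e1, e2] at h
  linarith

theorem exists_hasDerivAt_moment_ratio_pos {n : ℕ} (hn : 0 < n) {ρ : ℝ} (h0 : 0 < ρ)
    (hρ : ρ < maxRadius n) :
    ∃ r, 0 < r ∧
      HasDerivAt (fun ρ => circleMoment (weight n n) ρ / circleMoment (weight n 0) ρ) r ρ := by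
  have hρ' : |ρ| < maxRadius n := by rwa [abs_of_pos h0]
  have hd := fun k => hasDerivAt_circleMoment (fun x hx => hasDerivAt_position_pow hn k hx)
    (fun x hx => continuousAt_weight hn k hx) h0.ne' hρ'
  have hpos := circleMoment_weight_zero_pos hn h0 hρ
  refine ⟨_, ?_, (hd n).div (hd 0) hpos.ne'⟩
  refine div_pos ?_ (by positivity)
  rw [circleMoment_eq, circleMoment_eq]
  -- The numerator of the quotient rule is `ρ³` times the Chebyshev difference: `ρ` from the
  -- derivative, `ρ²` from the moment.
  have h := mul_pos (pow_pos h0 3) (sub_pos.2 (integral_weight_mul_lt hn h0 hρ))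
  linarith

/-- The ratio is an average of `u ^ n` against a positive weight, and `u` tends to `0` uniformly on
the shrinking circle. -/
theorem tendsto_moment_ratio {n : ℕ} (hn : 0 < n) :
    Tendsto (fun ρ => circleMoment (weight n n) ρ / circleMoment (weight n 0) ρ)
      (𝓝[>] 0) (𝓝 0) := by
  rw [Metric.tendsto_nhds]
  intro ε hε
  have hc : ContinuousAt (fun x => |position n x ^ n|) 0 :=
    ((continuousAt_position hn (by simpa using maxRadius_pos hn)).pow n).abs
  have hlt : |position n 0 ^ n| < ε / 2 := by
    rw [position_zero hn, zero_pow hn.ne', abs_zero]; positivity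
  obtain ⟨δ, hδ, hball⟩ := Metric.eventually_nhds_iff.1 (hc.eventually_lt continuousAt_const hlt)
  filter_upwards [Ioo_mem_nhdsGT (lt_min hδ (maxRadius_pos hn))] with ρ hρ
  have h0 : 0 < ρ := hρ.1
  have hρδ : |ρ| < δ := by rw [abs_of_pos h0]; exact hρ.2.trans_le (min_le_left _ _)
  have hρR := hρ.2.trans_le (min_le_right _ _)
  have hρ' : |ρ| < maxRadius n := by rwa [abs_of_pos h0]
  have hpos := circleMoment_weight_zero_pos hn h0 hρR
  have c : ∀ k, Continuous fun θ => weight n k (ρ * Real.sin θ) * (ρ * Real.cos θ) ^ 2 := fun k =>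
    (continuous_comp_mul_sin (fun x hx => continuousAt_weight hn k hx) hρ').mul (by fun_prop)
  have hle : |circleMoment (weight n n) ρ| ≤ ε / 2 * circleMoment (weight n 0) ρ := by
    rw [circleMoment, circleMoment, ← intervalIntegral.integral_const_mul, ← Real.norm_eq_abs]
    refine intervalIntegral.norm_integral_le_of_norm_le (by linarith [Real.pi_pos])
      (Eventually.of_forall fun θ _ => ?_) (((c 0).const_mul _).intervalIntegrable (μ := MeasureTheory.volume) _ _)
    have h1 : |position n (ρ * Real.sin θ) ^ n| < ε / 2 :=
      hball (by simpa using abs_mul_sin_lt hρδ θ)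
    have h2 := (weight_zero_pos hn (abs_mul_sin_lt hρ' θ)).le
    have h3 : weight n n (ρ * Real.sin θ) =
        position n (ρ * Real.sin θ) ^ n * weight n 0 (ρ * Real.sin θ) := by simp [weight]
    rw [h3, Real.norm_eq_abs, abs_mul, abs_mul, abs_of_nonneg h2, abs_of_nonneg (sq_nonneg (ρ * Real.cos θ)),
      mul_assoc]
    gcongr
  rw [dist_zero_right, Real.norm_eq_abs, abs_div, abs_of_pos hpos, div_lt_iff₀ hpos]
  nlinarith

/-! ### Existence of periodic orbits, and every such orbit as a circle. -/

theorem sqrt_two_mul_lt_maxRadius {n : ℕ} {h : ℝ} (hh : h ∈ Ioo 0 (criticalEnergy n)) :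
    √(2 * h) < maxRadius n :=
  Real.sqrt_lt_sqrt (by linarith [hh.1]) (by linarith [hh.2])

theorem exists_periodicOrbit {n : ℕ} (hn : 0 < n) {h : ℝ} (hh : h ∈ Ioo 0 (criticalEnergy n)) :
    ∃ (u v : ℝ → ℝ) (T : ℝ), IsPeriodicOrbit n h u v T := by
  set ρ := √(2 * h) with hρdef
  have hρ0 : 0 < ρ := Real.sqrt_pos.2 (by linarith [hh.1])
  have hρ2 : ρ ^ 2 = 2 * h := Real.sq_sqrt (by linarith [hh.1])
  have hρ : |ρ| < maxRadius n := by
    rw [abs_of_pos hρ0]; exact sqrt_two_mul_lt_maxRadius hh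
  have hR : ∀ θ, |ρ * Real.sin θ| < maxRadius n := abs_mul_sin_lt hρ
  set g : ℝ → ℝ := fun θ => weight n 0 (ρ * Real.sin θ) with hg
  have hgc : Continuous g := continuous_comp_mul_sin (fun x hx => continuousAt_weight hn 0 hx) hρ
  have hgi : ∀ a b, IntervalIntegrable g MeasureTheory.volume a b :=
    fun a b => hgc.intervalIntegrable a b
  have hgp : ∀ θ, 0 < g θ := fun θ => weight_zero_pos hn (hR θ)
  have hgper : Function.Periodic g (2 * Real.pi) := fun θ => by simp [hg]
  have h2pi : (0 : ℝ) < 2 * Real.pi := by linarith [Real.pi_pos]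
  -- Along the circle `dt = du / v = (du/dx) dθ`. The integrand is positive and periodic, so `time`
  -- is an increasing bijection of the line; its inverse gives the angle at time `t`.
  set time : ℝ → ℝ := fun θ => ∫ s in (0 : ℝ)..θ, g s with htime
  have htd : ∀ θ, HasDerivAt time (g θ) θ := fun θ =>
    (hgc.integral_hasStrictDerivAt 0 θ).hasDerivAt
  have htc : Continuous time := continuous_iff_continuousAt.2 fun θ => (htd θ).continuousAt
  have htm : StrictMono time := strictMono_of_deriv_pos fun θ => by
    rw [(htd θ).deriv]; exact hgp θ
  have hts : Function.Surjective time := htc.surjective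
    (hgper.tendsto_atTop_intervalIntegral_of_pos' (hgi _ _) hgp h2pi)
    (hgper.tendsto_atBot_intervalIntegral_of_pos' (hgi _ _) hgp h2pi)
  set e := htm.orderIsoOfSurjective time hts with he
  have het : ∀ t, time (e.symm t) = t := fun t => e.apply_symm_apply t
  have hte : ∀ θ, e.symm (time θ) = θ := fun θ => e.symm_apply_apply θ
  set θ : ℝ → ℝ := fun t => e.symm t with hθ
  have hθd : ∀ t, HasDerivAt θ (g (θ t))⁻¹ t := fun t =>
    (htd (θ t)).of_local_left_inverse e.symm.continuous.continuousAt (hgp _).ne'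
      (Eventually.of_forall het)
  have hθp : ∀ t, θ (t + time (2 * Real.pi)) = θ t + 2 * Real.pi := by
    intro t
    have h1 : time (θ t + 2 * Real.pi) = time (θ t) + time (2 * Real.pi) := by
      have h2 := hgper.intervalIntegral_add_eq_add 0 (θ t) hgi
      rw [zero_add] at h2
      exact h2
    rw [het] at h1
    rw [← h1]
    exact hte _
  have hθ0 : θ 0 = 0 := by
    have := hte 0
    rwa [show time 0 = 0 from intervalIntegral.integral_same] at this
  have hg' : ∀ t, g t = timeDensity n (position n (ρ * Real.sin t)) := fun t => by
    simp [hg, weight]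
  refine ⟨fun t => position n (ρ * Real.sin (θ t)), fun t => ρ * Real.cos (θ t),
    time (2 * Real.pi), ?_, ?_, ?_, ?_, ?_, ?_⟩
  · intro t
    have h1 := ((hasDerivAt_position hn (hR (θ t))).comp t (((hθd t).sin).const_mul ρ))
    refine h1.congr_deriv ?_
    have h2 := (hgp (θ t)).ne'
    rw [← hg']
    field_simp
  · intro t
    refine (((hθd t).cos).const_mul ρ).congr_deriv ?_
    have h1 := energyRoot_mul_inv_timeDensity hn (abs_position_lt hn (hR (θ t)))
    rw [energyRoot_position hn (hR (θ t)), ← hg'] at h1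
    linear_combination -h1
  · intro t
    have h1 := two_mul_potential_position hn (hR (θ t))
    rw [hamiltonian]
    linear_combination h1 / 2 + hρ2 / 2 + ρ ^ 2 / 2 * Real.sin_sq_add_cos_sq (θ t)
  · have := htm h2pi
    rwa [show time 0 = 0 from intervalIntegral.integral_same] at this
  · intro t
    simp only [hθp, Real.sin_add_two_pi, Real.cos_add_two_pi, and_self]
  · rintro t h0 hT ⟨hu, hv⟩
    have hm : StrictMono θ := e.symm.strictMono
    have h1 := hm h0
    have h2 := hm hT
    rw [hθ0] at h1
    rw [show θ (time (2 * Real.pi)) = 2 * Real.pi from hte _] at h2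
    rw [hθ0, Real.cos_zero] at hv
    have hcos : Real.cos (θ t) = 1 := by
      have := mul_left_cancel₀ hρ0.ne' hv
      exact this
    have := (Real.cos_eq_one_iff_of_lt_of_lt (by linarith) h2).1 hcos
    linarith

/-- Energy forbids `|u| = saddle n`, so by continuity one time with `|u| ≤ saddle n` suffices.
Rolle's theorem for `v` over a period gives it: where `v' = 0`, `u` is the abscissa of an
equilibrium. -/
theorem IsPeriodicOrbit.abs_lt_saddle {n : ℕ} (hn : 0 < n) {h : ℝ} {u v : ℝ → ℝ} {T : ℝ}
    (hh : h < criticalEnergy n) (ho : IsPeriodicOrbit n h u v T) (t : ℝ) : |u t| < saddle n := by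
  have hne : ∀ t, |u t| ≠ saddle n := by
    intro t ht
    have h1 : criticalEnergy n ≤ potential n (u t) := by
      rcases abs_choice (u t) with hc | hc
      · rw [← hc, ht, potential_saddle hn]
      · rw [← neg_neg (u t), ← hc, ht]
        exact criticalEnergy_le_potential_neg_saddle hn
    have h2 := ho.energy t
    rw [hamiltonian] at h2
    nlinarith [sq_nonneg (v t)]
  have hcont : Continuous fun t => |u t| :=
    (continuous_iff_continuousAt.2 fun t => (ho.hasDerivAt_u t).continuousAt).abs
  obtain ⟨t₀, -, ht₀⟩ := exists_hasDerivAt_eq_zero ho.period_pos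
    (continuous_iff_continuousAt.2 fun t => (ho.hasDerivAt_v t).continuousAt).continuousOn
    (by simpa using (ho.periodic 0).2.symm) (fun t _ => ho.hasDerivAt_v t)
  have hle : |u t₀| ≤ saddle n := by
    have hn1 : (n : ℝ) + 1 ≠ 0 := by positivity
    have h1 : u t₀ * (u t₀ ^ n - (n + 1)) = 0 := by
      field_simp at ht₀
      linear_combination ht₀
    rcases mul_eq_zero.1 h1 with h1 | h1
    · rw [h1, abs_zero]; exact (saddle_pos n).le
    · rw [sub_eq_zero, ← saddle_pow hn] at h1
      refine le_of_eq ((pow_left_inj₀ (abs_nonneg _) (saddle_pos n).le hn.ne').1 ?_)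
      rw [← abs_pow, h1, abs_of_pos (pow_pos (saddle_pos n) n)]
  by_contra hlt
  obtain ⟨t₁, ht₁⟩ := mem_range_of_exists_le_of_exists_ge hcont ⟨t₀, hle⟩ ⟨t, not_lt.1 hlt⟩
  exact hne t₁ ht₁

theorem exists_angle {x v ρ : ℝ} (hρ : 0 < ρ) (h : x ^ 2 + v ^ 2 = ρ ^ 2) :
    ∃ θ, x = ρ * Real.sin θ ∧ v = ρ * Real.cos θ := by
  have hnorm : ‖(⟨v, x⟩ : ℂ)‖ = ρ := by
    rw [Complex.norm_def, Complex.normSq_mk, ← Real.sqrt_sq hρ.le]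
    congr 1
    linarith
  refine ⟨Complex.arg ⟨v, x⟩, ?_, ?_⟩
  · rw [← hnorm, Complex.norm_mul_sin_arg]
  · rw [← hnorm, Complex.norm_mul_cos_arg]

/-- With `ω = 1 / timeDensity`, the pair `(x, v)` solves the rotation system `x' = ω v`, `v' = -ω
x`. So does `ρ (sin θ, cos θ)` when `θ' = ω`; the squared distance of two solutions is constant, and
it vanishes at time `0`. -/
theorem IsPeriodicOrbit.exists_angle {n : ℕ} (hn : 0 < n) {h : ℝ} {u v : ℝ → ℝ} {T : ℝ}
    (hh : h ∈ Ioo 0 (criticalEnergy n)) (ho : IsPeriodicOrbit n h u v T) :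
    ∃ θ : ℝ → ℝ, (∀ t, HasDerivAt θ (timeDensity n (u t))⁻¹ t) ∧
      ∀ t, energyRoot n (u t) = √(2 * h) * Real.sin (θ t) ∧ v t = √(2 * h) * Real.cos (θ t) := by
  have hlt := ho.abs_lt_saddle hn hh.2
  set ρ := √(2 * h) with hρdef
  have hρ0 : 0 < ρ := Real.sqrt_pos.2 (by linarith [hh.1])
  have hρ2 : ρ ^ 2 = 2 * h := Real.sq_sqrt (by linarith [hh.1])
  have hcirc : ∀ t, energyRoot n (u t) ^ 2 + v t ^ 2 = ρ ^ 2 := by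
    intro t
    rw [energyRoot_sq hn (hlt t).le, hρ2, ← ho.energy t, hamiltonian]
    ring
  obtain ⟨θ₀, hx0, hv0⟩ := AbelianRatio.exists_angle hρ0 (hcirc 0)
  set ω : ℝ → ℝ := fun t => (timeDensity n (u t))⁻¹ with hω
  have hωc : Continuous ω := continuous_iff_continuousAt.2 fun t =>
    (ContinuousAt.comp (f := u) (continuousAt_timeDensity hn (hlt t))
      (ho.hasDerivAt_u t).continuousAt).inv₀ (timeDensity_pos hn (hlt t)).ne'
  set θ : ℝ → ℝ := fun t => θ₀ + ∫ s in (0 : ℝ)..t, ω s with hθ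
  have hθd : ∀ t, HasDerivAt θ (ω t) t := fun t =>
    (hωc.integral_hasStrictDerivAt 0 t).hasDerivAt.const_add θ₀
  have hθ0 : θ 0 = θ₀ := by simp [hθ]
  have hd : ∀ t, HasDerivAt (fun t => (energyRoot n (u t) - ρ * Real.sin (θ t)) ^ 2 +
      (v t - ρ * Real.cos (θ t)) ^ 2) 0 t := by
    intro t
    have h1 := ((hasDerivAt_energyRoot hn (hlt t)).comp t (ho.hasDerivAt_u t)).sub
      ((hθd t).sin.const_mul ρ)
    have h2 := (ho.hasDerivAt_v t).sub ((hθd t).cos.const_mul ρ)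
    refine ((h1.pow 2).add (h2.pow 2)).congr_deriv ?_
    have h3 := energyRoot_mul_inv_timeDensity hn (hlt t)
    simp only [Function.comp, Pi.sub_apply, hω]
    push_cast
    linear_combination (-2 * (v t - ρ * Real.cos (θ t))) * (-h3)
  refine ⟨θ, hθd, fun t => ?_⟩
  have hconst := is_const_of_deriv_eq_zero (fun t => (hd t).differentiableAt)
    (fun t => (hd t).deriv) t 0
  simp only [hθ0, ← hx0, ← hv0, sub_self] at hconst
  have hA := sq_nonneg (energyRoot n (u t) - ρ * Real.sin (θ t))
  have hB := sq_nonneg (v t - ρ * Real.cos (θ t))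
  constructor
  · exact sub_eq_zero.1 (pow_eq_zero_iff two_ne_zero |>.1 (by linarith))
  · exact sub_eq_zero.1 (pow_eq_zero_iff two_ne_zero |>.1 (by linarith))

theorem IsPeriodicOrbit.abelianIntegral_eq {n : ℕ} (hn : 0 < n) {h : ℝ} {u v : ℝ → ℝ} {T : ℝ}
    (hh : h ∈ Ioo 0 (criticalEnergy n)) (ho : IsPeriodicOrbit n h u v T) (k : ℕ) :
    abelianIntegral k u v T = circleMoment (weight n k) √(2 * h) := by
  have hlt := ho.abs_lt_saddle hn hh.2
  obtain ⟨θ, hθd, hθ⟩ := ho.exists_angle hn hh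
  have hρR := sqrt_two_mul_lt_maxRadius hh
  have hρ0 : 0 < √(2 * h) := Real.sqrt_pos.2 (by linarith [hh.1])
  generalize √(2 * h) = ρ at *
  have hρ : |ρ| < maxRadius n := by rwa [abs_of_pos hρ0]
  have hu : ∀ t, position n (ρ * Real.sin (θ t)) = u t := fun t => by
    rw [← (hθ t).1, position_energyRoot hn (hlt t)]
  have hτ : ∀ t, 0 < timeDensity n (u t) := fun t => timeDensity_pos hn (hlt t)
  have hm : StrictMono θ := strictMono_of_deriv_pos fun t => by
    rw [(hθd t).deriv]; exact inv_pos.2 (hτ t)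
  have hθc : Continuous θ := continuous_iff_continuousAt.2 fun t => (hθd t).continuousAt
  have hT : θ T = θ 0 + 2 * Real.pi := by
    have hp := ho.periodic 0
    rw [zero_add] at hp
    have hcos : Real.cos (θ T) = Real.cos (θ 0) := mul_left_cancel₀ hρ0.ne' (by
      rw [← (hθ T).2, ← (hθ 0).2, hp.2])
    have hsin : Real.sin (θ T) = Real.sin (θ 0) := mul_left_cancel₀ hρ0.ne' (by
      rw [← (hθ T).1, ← (hθ 0).1, hp.1])
    obtain ⟨m, hm'⟩ := Real.Angle.angle_eq_iff_two_pi_dvd_sub.1 (Real.Angle.cos_sin_inj hcos hsin)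
    have hpi := Real.pi_pos
    have h0T := hm ho.period_pos
    have hm0 : 0 < m := by
      have : (0 : ℝ) < m := (mul_pos_iff_of_pos_left (by linarith : 0 < 2 * Real.pi)).1
        (by linarith)
      exact_mod_cast this
    -- With two or more turns, the orbit would be back at its starting point after one turn, before
    -- `T`, against minimality of the period.
    have hm1 : m ≤ 1 := by
      by_contra hcon
      have h2 : (2 : ℝ) ≤ m := by exact_mod_cast (by omega : 2 ≤ m)
      obtain ⟨t, ht, het⟩ := intermediate_value_Ioo ho.period_pos.le hθc.continuousOn
        (show θ 0 + 2 * Real.pi ∈ Ioo (θ 0) (θ T) from ⟨by linarith, by nlinarith⟩)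
      refine ho.minimal t ht.1 ht.2 ⟨?_, ?_⟩
      · rw [← hu t, ← hu 0, het, Real.sin_add_two_pi]
      · rw [(hθ t).2, (hθ 0).2, het, Real.cos_add_two_pi]
    have : m = 1 := by omega
    rw [this] at hm'
    push_cast at hm'
    linarith
  set G : ℝ → ℝ := fun s => weight n k (ρ * Real.sin s) * (ρ * Real.cos s) ^ 2 with hG
  have hGc : Continuous G :=
    (continuous_comp_mul_sin (fun x hx => continuousAt_weight hn k hx) hρ).mul (by fun_prop)
  have hGp : Function.Periodic G (2 * Real.pi) := fun s => by simp [hG]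
  have hωc : Continuous fun t => (timeDensity n (u t))⁻¹ := continuous_iff_continuousAt.2 fun t =>
    (ContinuousAt.comp (f := u) (continuousAt_timeDensity hn (hlt t))
      (ho.hasDerivAt_u t).continuousAt).inv₀ (hτ t).ne'
  have hsub := intervalIntegral.integral_comp_mul_deriv (a := 0) (b := T) (fun t _ => hθd t)
    hωc.continuousOn hGc
  rw [hT, hGp.intervalIntegral_add_eq (θ 0) 0, zero_add] at hsub
  rw [circleMoment, ← hG, ← hsub, abelianIntegral, loopIntegral]
  refine intervalIntegral.integral_congr fun t _ => ?_
  have h2 := (hτ t).ne'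
  simp only [Function.comp, hG, weight, (ho.hasDerivAt_u t).deriv, hu, ← (hθ t).2]
  field_simp

end AbelianRatio

theorem proposition1 (n : ℕ) (hn : 0 < n) :
    (∀ h ∈ Set.Ioo (0 : ℝ) (AbelianRatio.criticalEnergy n),
      ∃ (u v : ℝ → ℝ) (T : ℝ), AbelianRatio.IsPeriodicOrbit n h u v T) ∧
    ∀ (u v : ℝ → ℝ → ℝ) (T : ℝ → ℝ),
      (∀ h ∈ Set.Ioo (0 : ℝ) (AbelianRatio.criticalEnergy n),
        AbelianRatio.IsPeriodicOrbit n h (u h) (v h) (T h)) →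
      (∀ h ∈ Set.Ioo (0 : ℝ) (AbelianRatio.criticalEnergy n),
        0 < AbelianRatio.abelianIntegral 0 (u h) (v h) (T h) ∧
        DifferentiableAt ℝ (AbelianRatio.abelianRatio n u v T) h ∧
        0 < deriv (AbelianRatio.abelianRatio n u v T) h) ∧
      Filter.Tendsto (AbelianRatio.abelianRatio n u v T) (nhdsWithin 0 (Set.Ioi 0)) (nhds 0) := by
  refine ⟨fun h hh => AbelianRatio.exists_periodicOrbit hn hh, fun u v T ho => ?_⟩
  -- The integrals depend on `h` alone, not on the starting points chosen, so the family needs no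
  -- regularity in `h`.
  have hratio : ∀ h ∈ Ioo (0 : ℝ) (AbelianRatio.criticalEnergy n),
      AbelianRatio.abelianRatio n u v T h =
        AbelianRatio.circleMoment (AbelianRatio.weight n n) √(2 * h) /
          AbelianRatio.circleMoment (AbelianRatio.weight n 0) √(2 * h) := fun h hh => by
    rw [AbelianRatio.abelianRatio, (ho h hh).abelianIntegral_eq hn hh,
      (ho h hh).abelianIntegral_eq hn hh]
  refine ⟨fun h hh => ?_, ?_⟩
  · have h0 : 0 < 2 * h := by linarith [hh.1]
    have hs := Real.sqrt_pos.2 h0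
    have hρ := AbelianRatio.sqrt_two_mul_lt_maxRadius hh
    obtain ⟨r, hr, hd⟩ := AbelianRatio.exists_hasDerivAt_moment_ratio_pos hn hs hρ
    have hd' := (hd.comp h (((hasDerivAt_id h).const_mul 2).sqrt h0.ne')).congr_of_eventuallyEq
      (f₁ := AbelianRatio.abelianRatio n u v T) (by
        filter_upwards [isOpen_Ioo.mem_nhds hh] with y hy using hratio y hy)
    refine ⟨?_, hd'.differentiableAt, ?_⟩
    · rw [(ho h hh).abelianIntegral_eq hn hh]
      exact AbelianRatio.circleMoment_weight_zero_pos hn hs hρ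
    · rw [hd'.deriv]
      simp only [id]
      positivity
  · have hsqrt : Tendsto (fun h : ℝ => √(2 * h)) (𝓝[>] 0) (𝓝[>] 0) := by
      refine tendsto_nhdsWithin_iff.2 ⟨?_, ?_⟩
      · have : Continuous fun h : ℝ => √(2 * h) := by fun_prop
        simpa using (this.tendsto 0).mono_left nhdsWithin_le_nhds
      · filter_upwards [self_mem_nhdsWithin] with h hh
        exact Real.sqrt_pos.2 (by linarith [mem_Ioi.1 hh])
    refine ((AbelianRatio.tendsto_moment_ratio hn).comp hsqrt).congr' ?_
    filter_upwards [Ioo_mem_nhdsGT (AbelianRatio.criticalEnergy_pos hn)] with h hh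
    exact (hratio h hh).symm
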